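/- Conventions. The Genocchi numbers $G_0, G_1, G_2, \dots$ are defined by the generating function $\sum_{n\ge 0} G_n \frac{t^n}{n!} = \frac{2t}{e^t+1}$. Let $K$ and $N$ be finite sets of positive integers, whose elements are called blue and red numbers respectively, and let $*$ be an additional symbol, which occurs in blue and in red. A Callan sequence on $(K,N)$ is a sequence $(B_1,R_1)(B_2,R_2)\cdots(B_r,R_r)(B^*,R^*)$ with $r\ge 0$ such that $B_1,\dots,B_r,B^*$ are the $r+1$ non-empty blocks of a set partition of $K\cup\{*\}$, $R_1,\dots,R_r,R^*$ are the $r+1$ non-empty blocks of a set partition of $N\cup\{*\}$, $*\in B^*$ and $*\in R^*$. The $r+1$ pairs are called its Callan pairs. For integers $k,n,m\ge 0$, an $m$-barred Callan sequence of size $k\times n$ is a sequence whose elements are $m$ blue bars labelled $1,\dots,m$ (each label used once), $m+1$ red bars labelled $0,\dots,m$ (each label used once), and the Callan pairs, in order, of a Callan sequence on $K=\{m+1,\dots,m+k\}$ and $N=\{m+1,\dots,m+n\}$, such that - each blue bar with label $i$ is immediately followed by a (blue or red) bar with label strictly smaller than $i$; - each red bar with label $i$ is immediately followed either by a Callan pair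 or by a (blue or red) bar with label strictly greater than $i$. In particular, the last element of the sequence is not a bar. Let $C_n^k(m)$ be the number of $m$-barred Callan sequences of size $k\times n$. Theorem. For all integers $n,m\ge 0$, $$\sum_{j=0}^{n} (-1)^j\, C_{n-j}^{j}(m) = (-1)^{m+1}\, G_{n+2m+2}.$$ -/

import Mathlib

namespace Callan

/-- A letter of either colour: `some a` is the number `a` and `none` is the symbol `*`. -/
abbrev Letter := Option ℕ

/-- A pair consisting of a blue block (first component) and a red block (second component). -/
abbrev BlockPair := Finset Letter × Finset Letter

/-- The list of blocks `L` is an ordered partition of `S`: the blocks are non-empty and pairwise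
disjoint, and their union is `S`. -/
def IsOrderedPartition (S : Finset Letter) (L : List (Finset Letter)) : Prop :=
  (∀ B ∈ L, B.Nonempty) ∧ L.Pairwise Disjoint ∧ ∀ x, x ∈ S ↔ ∃ B ∈ L, x ∈ B

/-- `c` is a Callan sequence on the blue letters `K ∪ {*}` and the red letters `N ∪ {*}`: it
consists of ordinary pairs followed by one extra pair, the blue blocks partition `K ∪ {*}`, the red
blocks partition `N ∪ {*}`, and both blocks of the extra pair contain `*`. (The number of ordinary
pairs is then automatically at most the cardinality of `K` and of `N`.) -/
def IsCallanSequence (K N : Finset ℕ) (c : List BlockPair) : Prop :=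
  ∃ (ordinary : List BlockPair) (extra : BlockPair), c = ordinary ++ [extra] ∧
    IsOrderedPartition K.insertNone (c.map Prod.fst) ∧
    IsOrderedPartition N.insertNone (c.map Prod.snd) ∧
    none ∈ extra.1 ∧ none ∈ extra.2

/-- The elements of which barred sequences are made: labelled bars and pairs of blocks. -/
inductive Item where
  | blueBar (i : ℕ) : Item
  | redBar (i : ℕ) : Item
  | pair (p : BlockPair) : Item

namespace Item

/-- The label of a blue bar. -/
def blueLabel? : Item → Option ℕ
  | blueBar i => some i
  | redBar _ => none
  | pair _ => none

/-- The label of a red bar. -/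
def redLabel? : Item → Option ℕ
  | blueBar _ => none
  | redBar i => some i
  | pair _ => none

/-- The underlying pair of blocks of an item that is not a bar. -/
def pair? : Item → Option BlockPair
  | blueBar _ => none
  | redBar _ => none
  | pair p => some p

/-- `MayPrecede x y`: the item `x` may be immediately followed by the item `y`. A blue bar has to be
followed by a bar of strictly smaller label, and a red bar by a pair or by a bar of strictly larger
label; a pair may be followed by anything. -/
def MayPrecede : Item → Item → Prop
  | blueBar i, blueBar j => j < i
  | blueBar i, redBar j => j < i
  | blueBar _, pair _ => False
  | redBar i, blueBar j => i < j
  | redBar i, redBar j => i < j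
  | redBar _, pair _ => True
  | pair _, _ => True

end Item

/-- `s` is an `m`-barred Callan sequence with `k` blue numbers and `n` red numbers. -/
structure IsBarred (k n m : ℕ) (s : List Item) : Prop where
  /-- The blue bars are labelled by `1, …, m`, each label being used once. -/
  blueBars : (s.filterMap Item.blueLabel?).Perm (List.range' 1 m)
  /-- The red bars are labelled by `0, …, m`, each label being used once. -/
  redBars : (s.filterMap Item.redLabel?).Perm (List.range (m + 1))
  /-- The pairs, in the order in which they occur, form a Callan sequence on the blue numbers
  `m + 1, …, m + k` and the red numbers `m + 1, …, m + n`. -/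
  pairs : IsCallanSequence (Finset.Icc (m + 1) (m + k)) (Finset.Icc (m + 1) (m + n))
    (s.filterMap Item.pair?)
  /-- Consecutive items are compatible. -/
  chain : s.IsChain Item.MayPrecede
  /-- Every bar is followed by some item, that is, the last item is not a bar. -/
  last : ∃ p, s.getLast? = some (Item.pair p)

/-- The number of `m`-barred Callan sequences with `k` blue numbers and `n` red numbers. -/
noncomputable def barredCount (k n m : ℕ) : ℕ := {s : List Item | IsBarred k n m s}.ncard

/-- The Genocchi numbers `G_n`, defined by `∑ G_n t ^ n / n! = 2 t / (e ^ t + 1)`. -/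
noncomputable def genocchi (n : ℕ) : ℚ :=
  (n.factorial : ℚ) *
    PowerSeries.coeff n (2 * PowerSeries.X * (PowerSeries.exp ℚ + 1)⁻¹ : PowerSeries ℚ)

end Callan

namespace Callan

/-! Cut a barred sequence after each of its `r + 1` pairs. What remains is a Callan sequence
together with a list of `r + 1` words of bars, chosen independently, because whether a bar may
precede a pair does not depend on the blocks (`isBarred_encode`). There are `starSurj k r * starSurj
n r` Callan sequences, one factor per colour, and `gandhi m (r + 1)` lists of words
(`ncard_isWords`): removing the two bars of largest label yields the recurrence given by the
operator x²Δ. Hence `barredCount_eq_sum`.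

The alternating sum over `j` then replaces the product of the two `starSurj` factors by `starConv n
r`. The recurrence of `starConv` from `n` to `n + 2` is adjoint, up to sign, to x²Δ at positive
integers. So lowering `n` by 2 raises `m` by 1, and for `n = 2 * p` the sum collapses to `(-1) ^ p *
gandhi (m + p) 1`. For odd `n` both sides vanish.

It remains to see that `gandhi m 1` is a Genocchi number up to sign (`gandhi_one`). The functional
sending X^n to G_n is evaluated on X² ∏(X² - i²), where multiplication by X² reproduces the
recurrence of `gandhi`. -/

/-! ### Genocchi numbers and the iterates of x²Δ. -/

open Polynomial in
/-- The linear functional on polynomials sending `X ^ n` to the Genocchi number `G_n`. -/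
noncomputable def genocchiFunctional : ℚ[X] →ₗ[ℚ] ℚ :=
  Polynomial.lsum fun n => LinearMap.toSpanSingleton ℚ ℚ (genocchi n)

/-- The iterates of the operator `x ^ 2 Δ` applied to the identity function. -/
def gandhi : ℕ → ℕ → ℚ
  | 0, x => x
  | m + 1, x => x ^ 2 * (gandhi m (x + 1) - gandhi m x)

/-- The power series `2 t / (e ^ t + 1)`. -/
noncomputable def genocchiSeries : PowerSeries ℚ :=
  2 * PowerSeries.X * (PowerSeries.exp ℚ + 1)⁻¹

theorem exp_add_one_mul_genocchiSeries :
    (PowerSeries.exp ℚ + 1) * genocchiSeries = 2 * PowerSeries.X := by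
  have h : PowerSeries.constantCoeff (PowerSeries.exp ℚ + 1) ≠ 0 := by
    simp
  rw [genocchiSeries, mul_left_comm, PowerSeries.mul_inv_cancel _ h, mul_one]

theorem coeff_genocchiSeries (n : ℕ) :
    PowerSeries.coeff n genocchiSeries = genocchi n / n.factorial := by
  rw [genocchi, genocchiSeries]
  field_simp

theorem sum_choose_mul_genocchi (n : ℕ) :
    ∑ i ∈ Finset.range (n + 1), (n.choose i : ℚ) * genocchi i + genocchi n =
      if n = 1 then 2 else 0 := by
  have h := congrArg (PowerSeries.coeff n) exp_add_one_mul_genocchiSeries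
  rw [add_mul, one_mul, map_add, PowerSeries.coeff_mul,
    show (2 : PowerSeries ℚ) = PowerSeries.C 2 from (map_ofNat PowerSeries.C 2).symm, PowerSeries.coeff_C_mul,
    PowerSeries.coeff_X, Finset.Nat.sum_antidiagonal_eq_sum_range_succ_mk,
    ← Finset.sum_range_reflect] at h
  simp only [coeff_genocchiSeries, PowerSeries.coeff_exp] at h
  have hn : (n.factorial : ℚ) ≠ 0 := by positivity
  have h2 := congrArg (fun t => (n.factorial : ℚ) * t) h
  simp only [mul_add, Finset.mul_sum] at h2
  have e1 : (n.factorial : ℚ) * (genocchi n / n.factorial) = genocchi n := by field_simp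
  rw [e1] at h2
  have e2 : (n.factorial : ℚ) * (2 * if n = 1 then 1 else 0) = if n = 1 then 2 else 0 := by
    split_ifs with h1
    · subst h1; simp
    · simp
  rw [e2] at h2
  rw [← h2]
  congr 1
  refine Finset.sum_congr rfl fun i hi => ?_
  have hi' : i ≤ n := by simpa [Nat.lt_succ_iff] using hi
  rw [show n + 1 - 1 - i = n - i by omega, show n - (n - i) = i by omega, Nat.cast_choose ℚ hi']
  simp
  field_simp

/-- The series g = 2t/(e^t + 1) satisfies g(-t) = g(t) - 2t, so its only odd coefficient is the
linear one. -/
theorem genocchi_eq_zero_of_odd {n : ℕ} (hn : Odd n) (h1 : n ≠ 1) : genocchi n = 0 := by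
  have hE : PowerSeries.evalNegHom genocchiSeries = genocchiSeries - 2 * PowerSeries.X := by
    have h := exp_add_one_mul_genocchiSeries
    have h' := congrArg (PowerSeries.evalNegHom) h
    have hx := PowerSeries.exp_mul_exp_neg_eq_one (A := ℚ)
    simp only [map_mul, map_add, map_one, map_ofNat, PowerSeries.evalNegHom_X] at h'
    set e := PowerSeries.exp ℚ
    set e' := PowerSeries.evalNegHom e
    have hne : e + 1 ≠ 0 := by
      intro h0
      have := congrArg PowerSeries.constantCoeff h0
      simp [e] at this
    apply mul_left_cancel₀ hne
    linear_combination e * h' - h + (-PowerSeries.evalNegHom genocchiSeries) * hx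
  have h := congrArg (PowerSeries.coeff n) hE
  rw [PowerSeries.evalNegHom, PowerSeries.coeff_rescale, map_sub,
    show (2 : PowerSeries ℚ) = PowerSeries.C 2 from (map_ofNat PowerSeries.C 2).symm, PowerSeries.coeff_C_mul,
    PowerSeries.coeff_X, if_neg h1, hn.neg_one_pow, coeff_genocchiSeries] at h
  have hf : (n.factorial : ℚ) ≠ 0 := by positivity
  field_simp at h
  linarith

section Functional

open Polynomial

theorem genocchiFunctional_X_pow (n : ℕ) : genocchiFunctional (X ^ n) = genocchi n := by
  rw [genocchiFunctional, Polynomial.lsum_apply, X_pow_eq_monomial, Polynomial.sum_monomial_index]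
  · simp
  · simp

/-- This is (e^t + 1) g = 2t in dual form: multiplication by e^t corresponds to the shift X ↦ X + 1.
-/
theorem genocchiFunctional_comp_add (p : ℚ[X]) :
    genocchiFunctional (p.comp (X + 1)) + genocchiFunctional p = 2 * p.coeff 1 := by
  induction p using Polynomial.induction_on' with
  | add p q hp hq => rw [add_comp, map_add, map_add, coeff_add]; linear_combination hp + hq
  | monomial n a =>
    have h := sum_choose_mul_genocchi n
    rw [← C_mul_X_pow_eq_monomial, mul_comp, C_comp, X_pow_comp, ← smul_eq_C_mul, ← smul_eq_C_mul,
      map_smul, map_smul, genocchiFunctional_X_pow, add_pow]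
    simp only [one_pow, mul_one, map_sum]
    have : ∀ i, genocchiFunctional (X ^ i * (n.choose i : ℚ[X])) = n.choose i * genocchi i := by
      intro i
      rw [← C_eq_natCast, mul_comm, ← smul_eq_C_mul, map_smul, genocchiFunctional_X_pow,
        smul_eq_mul]
    simp only [this, smul_eq_mul, coeff_smul, coeff_X_pow]
    rw [← mul_add, h]
    by_cases h1 : n = 1
    · simp [h1, mul_comm]
    · simp [h1, Ne.symm h1]

/-- The product `(X ^ 2 - 1) ⋯ (X ^ 2 - r ^ 2)`. -/
noncomputable def centralProduct (r : ℕ) : ℚ[X] :=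
  ∏ i ∈ Finset.range r, (X ^ 2 - ((i : ℚ[X]) + 1) ^ 2)

theorem centralProduct_succ (r : ℕ) :
    centralProduct (r + 1) = centralProduct r * (X ^ 2 - ((r : ℚ[X]) + 1) ^ 2) :=
  Finset.prod_range_succ _ _

/-- `X * centralProduct r` is the product of X + i over -r ≤ i ≤ r. The shift slides this window by
one, and both sides are the product over -r ≤ i ≤ r + 1. -/
theorem centralProduct_comp (r : ℕ) :
    (X + 1) * (centralProduct r).comp (X + 1) * (X - (r : ℚ[X])) =
      X * centralProduct r * (X + (r : ℚ[X]) + 1) := by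
  induction r with
  | zero => simp [centralProduct]; ring
  | succ r ih =>
    rw [centralProduct_succ]
    simp only [mul_comp, sub_comp, pow_comp, X_comp, add_comp, natCast_comp, one_comp]
    push_cast
    linear_combination (X - (r : ℚ[X]) - 1) * (X + (r : ℚ[X]) + 2) * ih

theorem coeff_zero_centralProduct (r : ℕ) :
    (centralProduct r).coeff 0 = (-1) ^ r * (r.factorial : ℚ) ^ 2 := by
  rw [coeff_zero_eq_eval_zero]
  induction r with
  | zero => simp [centralProduct]
  | succ r ih =>
    rw [centralProduct_succ, eval_mul, ih, Nat.factorial_succ]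
    simp
    ring

theorem genocchiFunctional_centralProduct (r : ℕ) :
    genocchiFunctional (X ^ 2 * centralProduct r) =
      (-1) ^ (r + 1) * (r.factorial : ℚ) ^ 2 * (r + 1) := by
  -- The factor X - r - 1 becomes X - r under the shift, so `centralProduct_comp` applies. The
  -- shifted polynomial then carries X + r + 1 in its place, and the two factors add up to 2X.
  have h := genocchiFunctional_comp_add (X * (centralProduct r * (X - (r : ℚ[X]) - 1)))
  rw [← map_add] at h
  have e : (X * (centralProduct r * (X - (r : ℚ[X]) - 1))).comp (X + 1) +
      X * (centralProduct r * (X - (r : ℚ[X]) - 1)) =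
      (2 : ℚ) • (X ^ 2 * centralProduct r) := by
    simp only [mul_comp, sub_comp, X_comp, natCast_comp, one_comp]
    rw [smul_eq_C_mul, show (C (2 : ℚ)) = 2 from rfl]
    linear_combination centralProduct_comp r
  rw [e, map_smul, coeff_X_mul, mul_coeff_zero, coeff_zero_centralProduct, smul_eq_mul] at h
  have e2 : (X - (r : ℚ[X]) - 1).coeff 0 = -((r : ℚ) + 1) := by
    simp; ring
  rw [e2] at h
  rw [pow_succ (-1 : ℚ) r]
  linarith

/-- Writing X² = (X² - (r + 1)²) + (r + 1)² moves part of the product to index `r + 1`. After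
division by the sign and the squared factorial this is the recurrence of `gandhi` at `r + 1`. -/
theorem genocchiFunctional_X_pow_mul_centralProduct (p r : ℕ) :
    genocchiFunctional (X ^ (2 * p) * (X ^ 2 * centralProduct r)) =
      (-1) ^ (r + 1 + p) * (r.factorial : ℚ) ^ 2 * gandhi p (r + 1) := by
  induction p generalizing r with
  | zero => simp [genocchiFunctional_centralProduct, gandhi]
  | succ p ih =>
    have e : X ^ (2 * (p + 1)) * (X ^ 2 * centralProduct r) =
        X ^ (2 * p) * (X ^ 2 * centralProduct (r + 1)) +
        (((r : ℚ) + 1) ^ 2) • (X ^ (2 * p) * (X ^ 2 * centralProduct r)) := by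
      rw [centralProduct_succ, smul_eq_C_mul]
      simp only [map_pow, map_add, map_natCast, map_one]
      ring
    rw [e, map_add, map_smul, ih, ih, gandhi, Nat.factorial_succ, smul_eq_mul]
    push_cast
    ring

theorem gandhi_one (m : ℕ) : gandhi m 1 = (-1) ^ (m + 1) * genocchi (2 * m + 2) := by
  have h := genocchiFunctional_X_pow_mul_centralProduct m 0
  simp only [centralProduct, Finset.range_zero, Finset.prod_empty, mul_one, ← pow_add,
    genocchiFunctional_X_pow, Nat.factorial_zero, Nat.cast_one, one_pow, zero_add] at h
  rw [h, ← mul_assoc, ← pow_add, show m + 1 + (1 + m) = 2 * (m + 1) by ring, pow_mul]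
  simp

end Functional

/-! ### Star surjections and their alternating convolution. -/

/-- The number of maps from a `k`-element set to `r + 1` classes such that the first `r` classes are
hit. -/
def starSurj : ℕ → ℕ → ℕ
  | 0, 0 => 1
  | 0, _ + 1 => 0
  | k + 1, 0 => starSurj k 0
  | k + 1, r + 1 => (r + 2) * starSurj k (r + 1) + (r + 1) * starSurj k r

theorem starSurj_succ (k r : ℕ) :
    starSurj (k + 1) r = (r + 1) * starSurj k r + r * starSurj k (r - 1) := by
  cases r <;> simp [starSurj]

theorem starSurj_eq_zero {k r : ℕ} (h : k < r) : starSurj k r = 0 := by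
  induction k generalizing r with
  | zero => cases r <;> simp_all [starSurj]
  | succ k ih => rw [starSurj_succ, ih (by omega), ih (by omega)]; simp

/-- The ordinary generating function of `starSurj · r`. -/
noncomputable def starSeries (r : ℕ) : PowerSeries ℚ := PowerSeries.mk fun k => starSurj k r

theorem starSeries_zero : (1 - PowerSeries.X) * starSeries 0 = 1 := by
  ext n
  rw [sub_mul, one_mul, map_sub]
  cases n with
  | zero => simp [starSeries, starSurj]
  | succ n =>
    rw [PowerSeries.coeff_succ_X_mul]
    simp [starSeries, starSurj, PowerSeries.coeff_one]

theorem starSeries_succ (r : ℕ) :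
    (1 - ((r : PowerSeries ℚ) + 2) * PowerSeries.X) * starSeries (r + 1) =
      ((r : PowerSeries ℚ) + 1) * PowerSeries.X * starSeries r := by
  have e1 : ((r : PowerSeries ℚ) + 2) = PowerSeries.C ((r : ℚ) + 2) := by
    rw [map_add, map_natCast, map_ofNat]
  have e2 : ((r : PowerSeries ℚ) + 1) = PowerSeries.C ((r : ℚ) + 1) := by simp
  ext n
  rw [sub_mul, one_mul, map_sub, e1, e2, mul_assoc, mul_assoc, PowerSeries.coeff_C_mul,
    PowerSeries.coeff_C_mul]
  cases n with
  | zero => simp [starSeries, starSurj]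
  | succ n =>
    rw [PowerSeries.coeff_succ_X_mul, PowerSeries.coeff_succ_X_mul]
    simp [starSeries, starSurj]

/-- The alternating convolution of `starSurj · r` with itself. -/
noncomputable def starConv (n r : ℕ) : ℚ :=
  ∑ j ∈ Finset.range (n + 1), (-1) ^ j * ((starSurj j r : ℚ) * starSurj (n - j) r)

theorem mk_starConv (r : ℕ) : PowerSeries.mk (fun n => starConv n r) =
    PowerSeries.evalNegHom (starSeries r) * starSeries r := by
  ext n
  rw [PowerSeries.coeff_mul, Finset.Nat.sum_antidiagonal_eq_sum_range_succ_mk]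
  simp [starConv, starSeries, PowerSeries.evalNegHom, PowerSeries.coeff_rescale, mul_assoc]

/-- The reversal j ↦ n - j swaps the two factors and flips the sign. -/
theorem starConv_of_odd {n : ℕ} (hn : Odd n) (r : ℕ) : starConv n r = 0 := by
  have h : starConv n r = -starConv n r := by
    conv_lhs => rw [starConv, ← Finset.sum_range_reflect]
    rw [starConv, ← Finset.sum_neg_distrib]
    refine Finset.sum_congr rfl fun j hj => ?_
    have hj' : j ≤ n := by simpa [Nat.lt_succ_iff] using hj
    rw [show n + 1 - 1 - j = n - j by omega, show n - (n - j) = j by omega]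
    have : (-1 : ℚ) ^ (n - j) = -(-1) ^ j := by
      have h1 : (-1 : ℚ) ^ (n - j) * (-1) ^ j = -1 := by
        rw [← pow_add, Nat.sub_add_cancel hj', hn.neg_one_pow]
      rcases neg_one_pow_eq_or ℚ j with h | h <;> rw [h] at h1 ⊢ <;> linarith
    rw [this]; ring
  linarith

theorem starConv_zero (r : ℕ) : starConv 0 r = if r = 0 then 1 else 0 := by
  cases r <;> simp [starConv, starSurj]

theorem starConv_add_two_zero (n : ℕ) : starConv (n + 2) 0 = starConv n 0 := by
  have h0 := starSeries_zero
  have h1 := congrArg PowerSeries.evalNegHom h0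
  simp only [map_mul, map_sub, map_one, PowerSeries.evalNegHom_X] at h1
  have h : (PowerSeries.mk fun n => starConv n 0) =
      PowerSeries.X * (PowerSeries.X * PowerSeries.mk fun n => starConv n 0) + 1 := by
    rw [mk_starConv]
    linear_combination (1 + PowerSeries.X) * PowerSeries.evalNegHom (starSeries 0) * h0 + h1
  have := congrArg (PowerSeries.coeff (n + 2)) h
  rw [map_add, PowerSeries.coeff_succ_X_mul, PowerSeries.coeff_succ_X_mul,
    PowerSeries.coeff_one] at this
  simpa using this

/-- Let T_r be the generating function of `starConv · r`. Multiplying `starSeries_succ` by its image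
under t ↦ -t gives (1 - (r + 2)² t²) T_{r+1} = -(r + 1)² t² T_r. -/
theorem starConv_add_two_succ (n r : ℕ) : starConv (n + 2) (r + 1) =
    ((r : ℚ) + 2) ^ 2 * starConv n (r + 1) - ((r : ℚ) + 1) ^ 2 * starConv n r := by
  have h0 := starSeries_succ r
  have h1 := congrArg PowerSeries.evalNegHom h0
  simp only [map_mul, map_sub, map_one, map_add, map_natCast, map_ofNat,
    PowerSeries.evalNegHom_X] at h1
  have h : (PowerSeries.mk fun n => starConv n (r + 1)) =
      PowerSeries.X * (PowerSeries.X * (PowerSeries.C (((r : ℚ) + 2) ^ 2) *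
        PowerSeries.mk fun n => starConv n (r + 1))) -
      PowerSeries.X * (PowerSeries.X * (PowerSeries.C (((r : ℚ) + 1) ^ 2) *
        PowerSeries.mk fun n => starConv n r)) := by
    rw [mk_starConv, mk_starConv]
    simp only [map_pow, map_add, map_natCast, map_ofNat, map_one]
    linear_combination (1 + ((r : PowerSeries ℚ) + 2) * PowerSeries.X) *
      PowerSeries.evalNegHom (starSeries (r + 1)) * h0 +
      ((r : PowerSeries ℚ) + 1) * PowerSeries.X * starSeries r * h1
  have := congrArg (PowerSeries.coeff (n + 2)) h
  rw [map_sub] at this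
  simpa [PowerSeries.coeff_succ_X_mul, PowerSeries.coeff_C_mul, -map_pow, -map_add] using this

theorem starConv_eq_zero {n r : ℕ} (h : n < r) : starConv n r = 0 := by
  refine Finset.sum_eq_zero fun j hj => ?_
  have hj' : j ≤ n := by simpa [Nat.lt_succ_iff] using hj
  rw [starSurj_eq_zero (show j < r by omega)]
  simp

/-- Summation by parts: a step of 2 in `n` is traded for one application of x²Δ to `f`. -/
theorem sum_starConv_add_two (n M : ℕ) (hM : n < M) (f : ℕ → ℚ) :
    ∑ r ∈ Finset.range (M + 1), starConv (n + 2) r * f (r + 1) =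
      -∑ r ∈ Finset.range (M + 1),
        starConv n r * (((r + 1 : ℕ) : ℚ) ^ 2 * (f (r + 1 + 1) - f (r + 1))) := by
  -- For an arbitrary cut-off a boundary term remains; it is zero once the cut-off exceeds `n`.
  have key : ∀ N, ∑ r ∈ Finset.range (N + 1), starConv (n + 2) r * f (r + 1) =
      -∑ r ∈ Finset.range (N + 1),
        starConv n r * (((r + 1 : ℕ) : ℚ) ^ 2 * (f (r + 1 + 1) - f (r + 1))) +
        ((N + 1 : ℕ) : ℚ) ^ 2 * starConv n N * f (N + 2) := by
    intro N
    induction N with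
    | zero => simp [starConv_add_two_zero]; ring
    | succ N ih =>
      rw [Finset.sum_range_succ, ih, Finset.sum_range_succ _ (N + 1), starConv_add_two_succ]
      push_cast
      ring
  rw [key, starConv_eq_zero hM]
  simp

theorem sum_starConv_gandhi (p m M : ℕ) (hM : 2 * p < M) :
    ∑ r ∈ Finset.range (M + 1), starConv (2 * p) r * gandhi m (r + 1) =
      (-1) ^ p * gandhi (m + p) 1 := by
  induction p generalizing m with
  | zero => simp [starConv_zero]
  | succ p ih =>
    rw [mul_add, mul_one, sum_starConv_add_two _ _ (by omega)]
    have := ih (m + 1) (by omega)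
    simp only [gandhi] at this
    rw [this, pow_succ, show m + 1 + p = m + (p + 1) by ring]
    ring

theorem alternating_sum_eq_genocchi (n m M : ℕ) (hM : n < M) :
    ∑ r ∈ Finset.range (M + 1), starConv n r * gandhi m (r + 1) =
      (-1) ^ (m + 1) * genocchi (n + 2 * m + 2) := by
  rcases Nat.even_or_odd n with ⟨p, rfl⟩ | hn
  · rw [← two_mul, sum_starConv_gandhi p m M (by omega), gandhi_one,
      show 2 * p + 2 * m + 2 = 2 * (m + p) + 2 by ring, ← mul_assoc, ← pow_add,
      show p + (m + p + 1) = m + 1 + 2 * p by ring, pow_add, pow_mul]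
    simp
  · rw [genocchi_eq_zero_of_odd (by grind) (by omega)]
    simp [starConv_of_odd hn]

/-! ### Distributing the bars over words. -/

/-- The labelled bars of either colour. -/
inductive Bar where
  | blue (i : ℕ) : Bar
  | red (i : ℕ) : Bar
deriving DecidableEq

/-- A bar as an item of a barred sequence. -/
def Bar.toItem : Bar → Item
  | .blue i => .blueBar i
  | .red i => .redBar i

/-- A word of bars that may stand immediately before a pair. -/
def GoodWord (l : List Bar) : Prop :=
  (l.map Bar.toItem ++ [Item.pair (∅, ∅)]).IsChain Item.MayPrecede

/-- The indicator function of the bars of an `m`-barred sequence. -/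
def barLabels (m : ℕ) : Bar → ℕ
  | .blue i => if 1 ≤ i ∧ i ≤ m then 1 else 0
  | .red i => if i ≤ m then 1 else 0

/-- `w` distributes the bars of an `m`-barred sequence over words indexed by `A`. -/
structure IsWords (m : ℕ) (A : Finset ℕ) (w : ℕ → List Bar) : Prop where
  supp : ∀ i ∉ A, w i = []
  good : ∀ i, GoodWord (w i)
  count : ∀ x, ∑ i ∈ A, (w i).count x = barLabels m x

theorem barLabels_succ (m : ℕ) (x : Bar) : barLabels (m + 1) x =
    barLabels m x + (if x = .blue (m + 1) then 1 else 0) + (if x = .red (m + 1) then 1 else 0) := by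
  rcases x with i | i <;> simp [barLabels] <;> split_ifs <;> omega

theorem barLabels_blue_self (m : ℕ) : barLabels m (.blue (m + 1)) = 0 := by simp [barLabels]

theorem barLabels_red_self (m : ℕ) : barLabels m (.red (m + 1)) = 0 := by simp [barLabels]

theorem barLabels_ne_zero_of_mem {m : ℕ} {A : Finset ℕ} {w : ℕ → List Bar}
    (hs : ∀ i ∉ A, w i = []) (hc : ∀ x, ∑ i ∈ A, (w i).count x = barLabels m x)
    {i : ℕ} {x : Bar} (hx : x ∈ w i) : barLabels m x ≠ 0 := by
  have hi : i ∈ A := by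
    by_contra h
    simp [hs i h] at hx
  rw [← hc x]
  have h1 : 0 < (w i).count x := List.count_pos_iff.2 hx
  have h2 := Finset.single_le_sum (f := fun i => (w i).count x) (fun _ _ => Nat.zero_le _) hi
  omega

theorem exists_mem_of_barLabels_ne_zero {m : ℕ} {A : Finset ℕ} {w : ℕ → List Bar}
    (hw : IsWords m A w) {x : Bar} (hx : barLabels m x ≠ 0) : ∃ i ∈ A, x ∈ w i := by
  rw [← hw.count x] at hx
  obtain ⟨i, hi, h⟩ := Finset.exists_ne_zero_of_sum_ne_zero hx
  exact ⟨i, hi, List.count_pos_iff.1 (Nat.pos_of_ne_zero h)⟩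

theorem goodWord_nil : GoodWord [] := by simp [GoodWord]

theorem isChain_append_singleton_congr {α : Type*} {R : α → α → Prop} {l : List α} {c d : α}
    (h : ∀ x ∈ l, R x c ↔ R x d) : (l ++ [c]).IsChain R ↔ (l ++ [d]).IsChain R := by
  simp only [List.isChain_append, List.IsChain.singleton, true_and, List.head?_cons,
    Option.mem_def, Option.some.injEq, forall_eq']
  refine and_congr_right fun _ => forall₂_congr fun x hx => h x (List.mem_of_getLast? hx)

/-- For the bars allowed in `l`, a red bar of label `m + 1` is as good a successor as a pair, and a
pair may follow it. -/
theorem goodWord_append_red {m : ℕ} {l : List Bar}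
    (h : ∀ x ∈ l, barLabels m x ≠ 0 ∨ x = .blue (m + 1)) :
    GoodWord (l ++ [.red (m + 1)]) ↔ GoodWord l := by
  rw [GoodWord, List.map_append, List.map_singleton, List.append_assoc, List.singleton_append,
    List.isChain_append_cons_cons, GoodWord]
  simp only [List.IsChain.singleton, and_true]
  rw [and_iff_left (by simp [Bar.toItem, Item.MayPrecede])]
  apply isChain_append_singleton_congr
  intro y hy
  obtain ⟨x, hx, rfl⟩ := List.mem_map.1 hy
  have := h x hx
  rcases x with i | i <;> simp [Bar.toItem, Item.MayPrecede, barLabels] at this ⊢ <;> omega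

/-- To the bars of `u`, the blue bar of label `m + 1` acts as a pair, so the word splits there. It
accepts any bar of `v` as successor but not a pair, hence `v` is non-empty. -/
theorem goodWord_append_blue_cons {m : ℕ} {u v : List Bar}
    (hu : ∀ x ∈ u, barLabels m x ≠ 0) (hv : ∀ x ∈ v, barLabels m x ≠ 0) :
    GoodWord (u ++ .blue (m + 1) :: v) ↔ GoodWord u ∧ GoodWord v ∧ v ≠ [] := by
  rw [GoodWord, List.map_append, List.map_cons, List.append_assoc, List.cons_append,
    List.isChain_split]
  refine and_congr ?_ ?_
  · apply isChain_append_singleton_congr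
    intro y hy
    obtain ⟨x, hx, rfl⟩ := List.mem_map.1 hy
    have := hu x hx
    rcases x with i | i <;> simp [Bar.toItem, Item.MayPrecede, barLabels] at this ⊢ <;> omega
  · cases v with
    | nil => simp [Bar.toItem, Item.MayPrecede]
    | cons x v =>
      rw [List.map_cons, List.cons_append, List.isChain_cons_cons, and_comm, GoodWord]
      simp only [ne_eq, reduceCtorEq, not_false_eq_true, and_true, List.map_cons, List.cons_append]
      refine and_iff_left ?_
      have := hv x (by simp)
      rcases x with i | i <;> simp [Bar.toItem, Item.MayPrecede, barLabels] at this ⊢ <;> omega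

theorem GoodWord.eq_nil_of_red {m : ℕ} {l l' : List Bar}
    (h : GoodWord (l ++ .red m :: l')) (hl : ∀ x ∈ l', barLabels m x ≠ 0) : l' = [] := by
  rcases l' with _ | ⟨x, l'⟩
  · rfl
  rw [GoodWord, List.map_append, List.map_cons, List.append_assoc, List.cons_append,
    List.map_cons, List.cons_append, List.isChain_append_cons_cons] at h
  have h1 := h.2.1
  have h2 := hl x (by simp)
  rcases x with i | i <;> simp [Bar.toItem, Item.MayPrecede, barLabels] at h1 h2 <;> omega

/-- Merge the word indexed by `Q` into the word indexed by `b`, with a blue bar of label `m + 1` in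
between, and append a red bar of label `m + 1` to the word indexed by `a`. -/
def insertBars (m a b Q : ℕ) (w : ℕ → List Bar) (i : ℕ) : List Bar :=
  if i = Q then [] else
    (if i = b then w Q ++ .blue (m + 1) :: w b else w i) ++ (if i = a then [.red (m + 1)] else [])

section InsertBars

variable {m a b Q : ℕ} {A : Finset ℕ} {w : ℕ → List Bar}

theorem sum_count_insertBars (ha : a ∈ A) (hb : b ∈ A) (hQ : Q ∉ A) (x : Bar) :
    ∑ i ∈ A, (insertBars m a b Q w i).count x = ∑ i ∈ insert Q A, (w i).count x +
      (if x = .blue (m + 1) then 1 else 0) + (if x = .red (m + 1) then 1 else 0) := by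
  have h : ∀ i ∈ A, (insertBars m a b Q w i).count x = (w i).count x +
      (if i = b then (w Q).count x + (if x = .blue (m + 1) then 1 else 0) else 0) +
      (if i = a then (if x = .red (m + 1) then 1 else 0) else 0) := by
    intro i hi
    have : i ≠ Q := by rintro rfl; exact hQ hi
    rw [insertBars, if_neg this, List.count_append]
    congr 1
    · split_ifs with h1 h2
      · subst h1 h2; simp; omega
      · subst h1; rw [List.count_append, List.count_cons_of_ne (Ne.symm h2)]; omega
      · rfl
    · split_ifs with h1 h2
      · subst h2; simp
      · simp [Ne.symm h2]
      · simp
  rw [Finset.sum_congr rfl h, Finset.sum_add_distrib, Finset.sum_add_distrib,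
    Finset.sum_ite_eq' A b, Finset.sum_ite_eq' A a, if_pos ha, if_pos hb, Finset.sum_insert hQ]
  ring

theorem goodWord_insertBars (hQb : b ≠ Q) (hw : ∀ i, ∀ x ∈ w i, barLabels m x ≠ 0) :
    (∀ i, GoodWord (insertBars m a b Q w i)) ↔ (∀ i, GoodWord (w i)) ∧ w b ≠ [] := by
  have h : ∀ i, GoodWord (insertBars m a b Q w i) ↔ if i = Q then True else
      if i = b then GoodWord (w Q) ∧ GoodWord (w b) ∧ w b ≠ [] else GoodWord (w i) := by
    intro i
    rw [insertBars]
    split_ifs with h1 h2 h3 h3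
    · simp [goodWord_nil]
    · rw [goodWord_append_red, goodWord_append_blue_cons (hw _) (hw _)]
      intro x hx
      simp only [List.mem_append, List.mem_cons] at hx
      rcases hx with hx | rfl | hx
      · exact .inl (hw _ x hx)
      · exact .inr rfl
      · exact .inl (hw _ x hx)
    · rw [List.append_nil, goodWord_append_blue_cons (hw _) (hw _)]
    · exact goodWord_append_red fun x hx => .inl (hw _ x hx)
    · rw [List.append_nil]
  simp only [h]
  constructor
  · intro h
    have hb := h b
    rw [if_neg hQb, if_pos rfl] at hb
    refine ⟨fun i => ?_, hb.2.2⟩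
    have hi := h i
    split_ifs at hi with h1 h2
    · subst h1; exact hb.1
    · subst h2; exact hb.2.1
    · exact hi
  · rintro ⟨h, hb⟩ i
    split_ifs
    · exact ⟨h _, h _, hb⟩
    · exact h i

/-- The inductive step of the count. The part before the largest blue bar is stored at the new index
`Q`, the non-empty part after it stays at `b`, and the largest red bar closes the word at `a`. -/
theorem isWords_insertBars (ha : a ∈ A) (hb : b ∈ A) (hQ : Q ∉ A)
    (hs : ∀ i ∉ insert Q A, w i = []) :
    IsWords (m + 1) A (insertBars m a b Q w) ↔ IsWords m (insert Q A) w ∧ w b ≠ [] := by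
  have hQb : b ≠ Q := by rintro rfl; exact hQ hb
  have hcount : (∀ x, ∑ i ∈ A, (insertBars m a b Q w i).count x = barLabels (m + 1) x) ↔
      ∀ x, ∑ i ∈ insert Q A, (w i).count x = barLabels m x := by
    refine forall_congr' fun x => ?_
    rw [sum_count_insertBars ha hb hQ, barLabels_succ]
    omega
  constructor
  · intro h
    -- The count comes first: it bounds the labels occurring in `w` by `m`, as `goodWord_insertBars`
    -- requires.
    have hc := hcount.1 h.count
    have hg := (goodWord_insertBars hQb
      fun i x hx => barLabels_ne_zero_of_mem hs hc hx).1 h.good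
    exact ⟨⟨hs, hg.1, hc⟩, hg.2⟩
  · rintro ⟨h, hne⟩
    refine ⟨fun i hi => ?_, (goodWord_insertBars hQb
      fun i x hx => barLabels_ne_zero_of_mem hs h.count hx).2 ⟨h.good, hne⟩, hcount.2 h.count⟩
    have h1 : i ≠ a := by rintro rfl; exact hi ha
    have h2 : i ≠ b := by rintro rfl; exact hi hb
    rw [insertBars, if_neg h1, if_neg h2]
    split_ifs with h3
    · rfl
    · rw [hs i (by simp [h3, hi])]; rfl

theorem exists_insertBars {w' : ℕ → List Bar} (hw' : IsWords (m + 1) A w') (hQ : Q ∉ A) :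
    ∃ a ∈ A, ∃ b ∈ A, ∃ w, (∀ i ∉ insert Q A, w i = []) ∧ insertBars m a b Q w = w' := by
  obtain ⟨a, ha, hra⟩ := exists_mem_of_barLabels_ne_zero hw' (x := .red (m + 1))
    (by simp [barLabels])
  obtain ⟨b, hb, hbb⟩ := exists_mem_of_barLabels_ne_zero hw' (x := .blue (m + 1))
    (by simp [barLabels])
  obtain ⟨l, l', hl⟩ := List.append_of_mem hra
  have hl' : l' = [] := by
    refine GoodWord.eq_nil_of_red (hl ▸ hw'.good a) fun x hx => ?_
    exact barLabels_ne_zero_of_mem hw'.supp hw'.count (i := a) (by rw [hl]; simp [hx])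
  subst hl'
  have hb1 : .blue (m + 1) ∈ Function.update w' a l b := by
    by_cases h : b = a
    · subst h
      rw [hl] at hbb
      simpa using hbb
    · simpa [h] using hbb
  obtain ⟨u, v, huv⟩ := List.append_of_mem hb1
  have haQ : a ≠ Q := by rintro rfl; exact hQ ha
  have hbQ : b ≠ Q := by rintro rfl; exact hQ hb
  refine ⟨a, ha, b, hb, Function.update (Function.update (Function.update w' a l) b v) Q u,
    fun i hi => ?_, funext fun i => ?_⟩
  · simp only [Finset.mem_insert, not_or] at hi
    have h1 : i ≠ a := by rintro rfl; exact hi.2 ha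
    have h2 : i ≠ b := by rintro rfl; exact hi.2 hb
    simp [hi.1, h1, h2, hw'.supp i hi.2]
  · rw [insertBars]
    by_cases hiQ : i = Q
    · rw [if_pos hiQ, hiQ, hw'.supp Q hQ]
    rw [if_neg hiQ]
    by_cases hib : i = b
    · subst hib
      simp only [if_true, Function.update_self, Function.update_of_ne hiQ, ← huv]
      by_cases hia : i = a
      · subst hia; simp [hl]
      · simp [hia]
    · simp only [hib, if_false, Function.update_of_ne hiQ, ne_eq, not_false_eq_true,
        Function.update_of_ne]
      by_cases hia : i = a
      · subst hia; simp [hl]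
      · simp [hia]

theorem red_mem_insertBars (hw : ∀ i, ∀ x ∈ w i, barLabels m x ≠ 0) {i : ℕ} (hi : i ≠ Q) :
    .red (m + 1) ∈ insertBars m a b Q w i ↔ i = a := by
  have h : ∀ i, (.red (m + 1) : Bar) ∉ w i := fun i hm => hw i _ hm (barLabels_red_self m)
  rw [insertBars, if_neg hi]
  split_ifs <;> simp_all

theorem blue_mem_insertBars (hw : ∀ i, ∀ x ∈ w i, barLabels m x ≠ 0) {i : ℕ} (hi : i ≠ Q) :
    .blue (m + 1) ∈ insertBars m a b Q w i ↔ i = b := by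
  have h : ∀ i, (.blue (m + 1) : Bar) ∉ w i := fun i hm => hw i _ hm (barLabels_blue_self m)
  rw [insertBars, if_neg hi]
  split_ifs <;> simp_all

/-- The bars of label `m + 1` reveal `a` and `b`. As they do not occur in `w`, the blue one marks
the unique place where to cut. -/
theorem insertBars_inj {a' b' : ℕ} {w' : ℕ → List Bar}
    (ha : a ∈ A) (hb : b ∈ A) (hQ : Q ∉ A)
    (hw : IsWords m (insert Q A) w) (hw' : IsWords m (insert Q A) w')
    (h : insertBars m a b Q w = insertBars m a' b' Q w') : a = a' ∧ b = b' ∧ w = w' := by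
  have hm : ∀ i, ∀ x ∈ w i, barLabels m x ≠ 0 :=
    fun i x hx => barLabels_ne_zero_of_mem hw.supp hw.count hx
  have hm' : ∀ i, ∀ x ∈ w' i, barLabels m x ≠ 0 :=
    fun i x hx => barLabels_ne_zero_of_mem hw'.supp hw'.count hx
  have haQ : a ≠ Q := by rintro rfl; exact hQ ha
  have hbQ : b ≠ Q := by rintro rfl; exact hQ hb
  have h1 : a = a' := by
    rw [← red_mem_insertBars hm' (b := b') haQ, ← h, red_mem_insertBars hm haQ]
  have h2 : b = b' := by
    rw [← blue_mem_insertBars hm' (a := a') hbQ, ← h, blue_mem_insertBars hm hbQ]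
  subst h1 h2
  have hi : ∀ i ≠ Q, (if i = b then w Q ++ .blue (m + 1) :: w b else w i) =
      (if i = b then w' Q ++ .blue (m + 1) :: w' b else w' i) := by
    intro i hi
    have := congrFun h i
    rw [insertBars, insertBars, if_neg hi, if_neg hi] at this
    exact List.append_cancel_right this
  have hbb := hi b hbQ
  rw [if_pos rfl, if_pos rfl] at hbb
  have hn : (.blue (m + 1) : Bar) ∉ w Q := fun hx => hm _ _ hx (barLabels_blue_self m)
  have hn2 : (.blue (m + 1) : Bar) ∉ w b := fun hx => hm _ _ hx (barLabels_blue_self m)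
  have hsplit : w Q = w' Q ∧ w b = w' b := by
    have := (List.append_cons_inj_of_notMem hn hn2).1 hbb
    tauto
  refine ⟨rfl, rfl, funext fun i => ?_⟩
  by_cases hiQ : i = Q
  · rw [hiQ, hsplit.1]
  by_cases hib : i = b
  · rw [hib, hsplit.2]
  · simpa [hib] using hi i hiQ

end InsertBars

theorem isWords_insert_erase {m b Q : ℕ} {A : Finset ℕ} (hb : b ∈ A) (hQ : Q ∉ A)
    (w : ℕ → List Bar) :
    IsWords m (insert Q (A.erase b)) w ↔ IsWords m (insert Q A) w ∧ w b = [] := by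
  have hQb : b ≠ Q := by rintro rfl; exact hQ hb
  have hsum : w b = [] → ∀ x, ∑ i ∈ insert Q (A.erase b), (w i).count x =
      ∑ i ∈ insert Q A, (w i).count x := by
    intro h x
    refine Finset.sum_subset (Finset.insert_subset_insert _ (Finset.erase_subset _ _)) ?_
    intro i hi hi'
    have : i = b := by
      simp only [Finset.mem_insert, Finset.mem_erase] at hi hi'
      tauto
    rw [this, h]
    rfl
  constructor
  · intro h
    have hwb : w b = [] := h.supp b (by simp [hQb])
    refine ⟨⟨fun i hi => h.supp i ?_, h.good, fun x => ?_⟩, hwb⟩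
    · simp only [Finset.mem_insert, Finset.mem_erase] at hi ⊢
      tauto
    · rw [← hsum hwb, h.count]
  · rintro ⟨h, hwb⟩
    refine ⟨fun i hi => ?_, h.good, fun x => ?_⟩
    · by_cases hib : i = b
      · rw [hib, hwb]
      · refine h.supp i ?_
        simp only [Finset.mem_insert, Finset.mem_erase] at hi ⊢
        tauto
    · rw [hsum hwb, h.count]

theorem setOf_isWords_zero (A : Finset ℕ) : {w | IsWords 0 A w} =
    (fun a i => if i = a then [Bar.red 0] else []) '' (A : Set ℕ) := by
  have hB : ∀ x, barLabels 0 x = if x = .red 0 then 1 else 0 := by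
    rintro (i | i)
    · simp [barLabels]; omega
    · simp [barLabels]
  ext w
  simp only [Set.mem_ofPred_eq, Set.mem_image, Finset.mem_coe]
  constructor
  · intro hw
    obtain ⟨a, ha, h0⟩ := exists_mem_of_barLabels_ne_zero hw (x := .red 0) (by simp [barLabels])
    refine ⟨a, ha, ?_⟩
    have hmem : ∀ i, ∀ x ∈ w i, x = .red 0 := by
      intro i x hx
      have := barLabels_ne_zero_of_mem hw.supp hw.count hx
      rw [hB] at this
      by_contra h
      simp [h] at this
    have hcount := hw.count (.red 0)
    rw [hB, if_pos rfl, ← Finset.add_sum_erase A _ ha] at hcount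
    have hpos := List.count_pos_iff.2 h0
    have hlen : ∀ i, (w i).length = (w i).count (.red 0) := by
      intro i
      rw [eq_comm, List.count_eq_length]
      exact fun x hx => (hmem i x hx).symm
    funext i
    by_cases hia : i = a
    · rw [if_pos hia, hia]
      have h1 : (w a).length = 1 := by rw [hlen]; omega
      obtain ⟨y, hy⟩ := List.length_eq_one_iff.1 h1
      rw [hy, hmem a y (by simp [hy])]
    · rw [if_neg hia]
      by_cases hiA : i ∈ A
      · have h1 : (w i).count (.red 0) = 0 := by
          have h2 : ∑ j ∈ A.erase a, (w j).count (.red 0) = 0 := by omega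
          exact (Finset.sum_eq_zero_iff.1 h2) i (Finset.mem_erase.2 ⟨hia, hiA⟩)
        rw [← hlen] at h1
        exact (List.length_eq_zero_iff.1 h1).symm
      · exact (hw.supp i hiA).symm
  · rintro ⟨a, ha, rfl⟩
    refine ⟨fun i hi => ?_, fun i => ?_, fun x => ?_⟩
    · rw [if_neg]; rintro rfl; exact hi ha
    · split_ifs <;> simp [GoodWord, Bar.toItem, Item.MayPrecede]
    · have : ∀ i ∈ A, (if i = a then [(Bar.red 0 : Bar)] else []).count x =
          if i = a then (if x = .red 0 then 1 else 0) else 0 := by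
        intro i _
        split_ifs with h1 h2
        · subst h2; simp
        · simp [Ne.symm h2]
        · simp
      rw [Finset.sum_congr rfl this, Finset.sum_ite_eq' A a, if_pos ha, hB]

/-- The choices of `a` and `b` give the factor x², and the condition `w b ≠ []` gives the difference
Δ. For `m = 0` only the red bar 0 has to be placed. -/
theorem ncard_isWords (m : ℕ) (A : Finset ℕ) :
    {w | IsWords m A w}.Finite ∧ ({w | IsWords m A w}.ncard : ℚ) = gandhi m A.card := by
  induction m generalizing A with
  | zero =>
    rw [setOf_isWords_zero]
    refine ⟨A.finite_toSet.image _, ?_⟩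
    rw [Set.ncard_image_of_injective _ ?_, Set.ncard_coe_finset, gandhi]
    intro a a' h
    have := congrFun h a
    by_contra hne
    simp [hne] at this
  | succ m ih =>
    obtain ⟨Q, hQ⟩ := Infinite.exists_notMem_finset A
    have hfin : ∀ b, {w | IsWords m (insert Q A) w ∧ w b ≠ []}.Finite := fun b =>
      (ih (insert Q A)).1.subset fun w hw => hw.1
    have hcard : ∀ b ∈ A, ((hfin b).toFinset.card : ℚ) =
        gandhi m (A.card + 1) - gandhi m A.card := by
      intro b hb
      rw [← Set.ncard_eq_toFinset_card _ (hfin b)]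
      -- Families with an empty word at `b` are those on `insert Q (A.erase b)`, a set of the same
      -- size as `A`.
      have hd : {w | IsWords m (insert Q A) w ∧ w b ≠ []} =
          {w | IsWords m (insert Q A) w} \ {w | IsWords m (insert Q (A.erase b)) w} := by
        ext w
        simp only [Set.mem_ofPred_eq, Set.mem_sdiff, isWords_insert_erase hb hQ]
        tauto
      have hsub : {w | IsWords m (insert Q (A.erase b)) w} ⊆ {w | IsWords m (insert Q A) w} :=
        fun w hw => ((isWords_insert_erase hb hQ w).1 hw).1
      have h1 := Set.ncard_sdiff_add_ncard_of_subset hsub (ih (insert Q A)).1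
      rw [← hd] at h1
      have h2 := (ih (insert Q A)).2
      have h3 := (ih (insert Q (A.erase b))).2
      rw [Finset.card_insert_of_notMem hQ] at h2
      rw [Finset.card_insert_of_notMem (fun h => hQ (Finset.mem_of_mem_erase h)),
        Finset.card_erase_add_one hb] at h3
      rw [← h2, ← h3, ← h1]
      push_cast
      ring
    let F : Finset (Σ _ : ℕ × ℕ, ℕ → List Bar) := (A ×ˢ A).sigma fun p => (hfin p.2).toFinset
    have himg : {w | IsWords (m + 1) A w} =
        (fun t : Σ _ : ℕ × ℕ, ℕ → List Bar => insertBars m t.1.1 t.1.2 Q t.2) '' (F : Set _) := by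
      ext w
      simp only [Set.mem_ofPred_eq, Set.mem_image, Finset.mem_coe, F, Finset.mem_sigma,
        Finset.mem_product, Set.Finite.mem_toFinset]
      constructor
      · intro hw
        obtain ⟨a, ha, b, hb, v, hv, rfl⟩ := exists_insertBars hw hQ
        exact ⟨⟨(a, b), v⟩, ⟨⟨ha, hb⟩, (isWords_insertBars ha hb hQ hv).1 hw⟩, rfl⟩
      · rintro ⟨⟨⟨a, b⟩, v⟩, ⟨⟨ha, hb⟩, hv⟩, rfl⟩
        exact (isWords_insertBars ha hb hQ hv.1.supp).2 hv
    rw [himg]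
    refine ⟨F.finite_toSet.image _, ?_⟩
    rw [Set.InjOn.ncard_image, Set.ncard_coe_finset, Finset.card_sigma, Nat.cast_sum,
      Finset.sum_congr rfl fun p hp => hcard p.2 (Finset.mem_product.1 hp).2, Finset.sum_const,
      Finset.card_product, gandhi, nsmul_eq_mul]
    · push_cast
      ring
    · rintro ⟨⟨a, b⟩, v⟩ hv ⟨⟨a', b'⟩, v'⟩ hv' h
      simp only [F, Finset.mem_coe, Finset.mem_sigma, Finset.mem_product,
        Set.Finite.mem_toFinset, Set.mem_ofPred_eq] at hv hv'
      obtain ⟨rfl, rfl, rfl⟩ := insertBars_inj hv.1.1 hv.1.2 hQ hv.2.1 hv'.2.1 h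
      rfl

/-! ### Ordered partitions with the star in the last block. -/

/-- The maps from `Fin k` to `A` whose range contains `A` except possibly `s`. -/
def starMaps (k : ℕ) (A : Finset ℕ) (s : ℕ) : Finset (Fin k → ℕ) :=
  {f ∈ Fintype.piFinset fun _ => A | ∀ b ∈ A, b ≠ s → ∃ i, f i = b}

theorem mem_starMaps {k : ℕ} {A : Finset ℕ} {s : ℕ} {f : Fin k → ℕ} :
    f ∈ starMaps k A s ↔ (∀ i, f i ∈ A) ∧ ∀ b ∈ A, b ≠ s → ∃ i, f i = b := by
  simp [starMaps]

theorem cons_mem_starMaps_self {k : ℕ} {A : Finset ℕ} {s : ℕ} {f : Fin k → ℕ} (hs : s ∈ A) :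
    (Fin.cons s f : Fin (k + 1) → ℕ) ∈ starMaps (k + 1) A s ↔ f ∈ starMaps k A s := by
  simp only [mem_starMaps, Fin.forall_fin_succ, Fin.exists_fin_succ, Fin.cons_zero, Fin.cons_succ]
  grind

/-- Either `f` still covers everything required, or `v` is attained only by the new entry and `f`
avoids it. -/
theorem cons_mem_starMaps {k : ℕ} {A : Finset ℕ} {s v : ℕ} {f : Fin k → ℕ} (hv : v ∈ A) :
    (Fin.cons v f : Fin (k + 1) → ℕ) ∈ starMaps (k + 1) A s ↔
      f ∈ starMaps k A s ∨ f ∈ starMaps k (A.erase v) s := by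
  simp only [mem_starMaps, Fin.forall_fin_succ, Fin.exists_fin_succ, Fin.cons_zero, Fin.cons_succ,
    Finset.mem_erase]
  constructor
  · rintro ⟨⟨-, h1⟩, h2⟩
    by_cases h : ∃ i, f i = v
    · left
      grind
    · right
      push Not at h
      grind
  · grind

theorem card_starMaps (k : ℕ) {A : Finset ℕ} {s : ℕ} (hs : s ∈ A) :
    (starMaps k A s).card = starSurj k (A.card - 1) := by
  induction k generalizing A with
  | zero =>
    have hc : 0 < A.card := Finset.card_pos.2 ⟨s, hs⟩
    by_cases h : A.card = 1
    · obtain ⟨a, rfl⟩ := Finset.card_eq_one.1 h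
      rw [Finset.mem_singleton] at hs
      subst hs
      have : starMaps 0 {s} s = Finset.univ := by
        ext f
        simp only [mem_starMaps, Finset.mem_univ, iff_true]
        exact ⟨fun i => i.elim0, by simp⟩
      rw [this]
      simp [starSurj]
    · obtain ⟨b, hb, hbs⟩ := Finset.exists_mem_ne (show 1 < A.card by omega) s
      have : starMaps 0 A s = ∅ := by
        ext f
        simp only [mem_starMaps, Finset.notMem_empty, iff_false, not_and]
        intro _ h'
        obtain ⟨i, -⟩ := h' b hb hbs
        exact i.elim0
      rw [this, show A.card - 1 = (A.card - 2) + 1 by omega]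
      simp [starSurj]
  | succ k ih =>
    let G : ℕ → Finset (Fin k → ℕ) := fun v =>
      if v = s then starMaps k A s else starMaps k A s ∪ starMaps k (A.erase v) s
    have hG : ∀ v ∈ A, ∀ f, (Fin.cons v f : Fin (k + 1) → ℕ) ∈ starMaps (k + 1) A s ↔ f ∈ G v := by
      intro v hv f
      by_cases h : v = s
      · subst h
        rw [cons_mem_starMaps_self hv]
        simp [G]
      · rw [cons_mem_starMaps hv]
        simp [G, h]
    have hcardG : ∀ v ∈ A, (G v).card = starSurj k (A.card - 1) +
        if v = s then 0 else starSurj k (A.card - 2) := by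
      intro v hv
      by_cases h : v = s
      · simp [G, h, ih hs]
      · have hd : Disjoint (starMaps k A s) (starMaps k (A.erase v) s) := by
          rw [Finset.disjoint_left]
          intro f hf hf'
          obtain ⟨i, hi⟩ := (mem_starMaps.1 hf).2 v hv h
          have := (mem_starMaps.1 hf').1 i
          simp [hi] at this
        simp only [G, h, if_false]
        rw [Finset.card_union_of_disjoint hd, ih hs, ih (by simp [hs, Ne.symm h]),
          Finset.card_erase_of_mem hv]
        rfl
    have himg : starMaps (k + 1) A s =
        (A.sigma G).image fun t => (Fin.cons t.1 t.2 : Fin (k + 1) → ℕ) := by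
      ext f
      simp only [Finset.mem_image, Finset.mem_sigma]
      constructor
      · intro hf
        have h0 : f 0 ∈ A := (mem_starMaps.1 hf).1 0
        refine ⟨⟨f 0, Fin.tail f⟩, ⟨h0, (hG _ h0 _).1 ?_⟩, Fin.cons_self_tail f⟩
        rwa [Fin.cons_self_tail]
      · rintro ⟨⟨v, g⟩, ⟨hv, hg⟩, rfl⟩
        exact (hG v hv g).2 hg
    rw [himg, Finset.card_image_of_injective, Finset.card_sigma, Finset.sum_congr rfl hcardG,
      Finset.sum_add_distrib,
      ← Finset.add_sum_erase A (fun v => if v = s then 0 else starSurj k (A.card - 2)) hs,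
      starSurj_succ]
    · rw [Finset.sum_congr rfl fun v hv => if_neg (Finset.ne_of_mem_erase hv)]
      have hc : 0 < A.card := Finset.card_pos.2 ⟨s, hs⟩
      simp [Finset.card_erase_of_mem hs, show A.card - 1 + 1 = A.card by omega,
        show A.card - 1 - 1 = A.card - 2 by omega]
    · rintro ⟨v, f⟩ ⟨v', f'⟩ h
      obtain ⟨rfl, rfl⟩ := Fin.cons_injective2 h
      rfl

/-- The list of blocks `L` is an ordered partition of `K ∪ {*}` with `*` in the last block. -/
def IsStarPartition (K : Finset ℕ) (L : List (Finset Letter)) : Prop :=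
  IsOrderedPartition K.insertNone L ∧ ∃ o e, L = o ++ [e] ∧ none ∈ e

theorem isCallanSequence_iff (K N : Finset ℕ) (c : List BlockPair) :
    IsCallanSequence K N c ↔
      IsStarPartition K (c.map Prod.fst) ∧ IsStarPartition N (c.map Prod.snd) := by
  constructor
  · rintro ⟨o, e, rfl, h1, h2, h3, h4⟩
    exact ⟨⟨h1, o.map Prod.fst, e.1, by simp, h3⟩, ⟨h2, o.map Prod.snd, e.2, by simp, h4⟩⟩
  · rintro ⟨⟨h1, o1, e1, ho1, h3⟩, ⟨h2, o2, e2, ho2, h4⟩⟩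
    rcases c.eq_nil_or_concat' with rfl | ⟨o, e, rfl⟩
    · simp at ho1
    · refine ⟨o, e, rfl, h1, h2, ?_, ?_⟩
      · rw [List.map_append] at ho1
        have := List.append_inj_right' ho1 rfl
        simp only [List.map_cons, List.map_nil, List.cons.injEq, and_true] at this
        rwa [this]
      · rw [List.map_append] at ho2
        have := List.append_inj_right' ho2 rfl
        simp only [List.map_cons, List.map_nil, List.cons.injEq, and_true] at this
        rwa [this]

theorem isStarPartition_map_range (K : Finset ℕ) (r : ℕ) (B : ℕ → Finset Letter) :
    IsStarPartition K ((List.range (r + 1)).map B) ↔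
      (∀ i ≤ r, (B i).Nonempty) ∧ (∀ i ≤ r, ∀ j ≤ r, i ≠ j → Disjoint (B i) (B j)) ∧
        (∀ x, x ∈ K.insertNone ↔ ∃ i ≤ r, x ∈ B i) ∧ none ∈ B r := by
  rw [IsStarPartition, IsOrderedPartition, and_assoc, and_assoc]
  refine and_congr (by simp) (and_congr ?_ (and_congr ?_ ?_))
  · rw [List.pairwise_iff_getElem]
    simp only [List.length_map, List.length_range, List.getElem_map, List.getElem_range]
    constructor
    · intro h i hi j hj hij
      rcases lt_or_gt_of_ne hij with h1 | h1
      · exact h i j (by omega) (by omega) h1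
      · exact (h j i (by omega) (by omega) h1).symm
    · intro h i j hi hj hij
      exact h i (by omega) j (by omega) hij.ne
  · simp
  · rw [List.range_succ, List.map_append, List.map_singleton]
    constructor
    · rintro ⟨o, e, h, hn⟩
      have := List.append_inj_right' h rfl
      simp only [List.cons.injEq, and_true] at this
      rwa [this]
    · intro h
      exact ⟨_, _, rfl, h⟩

/-- The class of a letter: `*` belongs to the class `r`, and the classes of the elements of `K` are
given by `f`. -/
def letterClass {k : ℕ} {K : Finset ℕ} (e : K ≃ Fin k) (r : ℕ) (f : Fin k → ℕ) : Letter → ℕ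
  | none => r
  | some a => if h : a ∈ K then f (e ⟨a, h⟩) else 0

/-- The list of the classes of letters. -/
def classList {k : ℕ} {K : Finset ℕ} (e : K ≃ Fin k) (r : ℕ) (f : Fin k → ℕ) :
    List (Finset Letter) :=
  (List.range (r + 1)).map fun i => {x ∈ K.insertNone | letterClass e r f x = i}

section ClassList

variable {k : ℕ} {K : Finset ℕ} (e : K ≃ Fin k) (r : ℕ)

theorem letterClass_symm (f : Fin k → ℕ) (j : Fin k) :
    letterClass e r f (some ((e.symm j : K) : ℕ)) = f j := by
  simp [letterClass]

theorem isStarPartition_classList {f : Fin k → ℕ} (hf : f ∈ starMaps k (Finset.range (r + 1)) r) :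
    IsStarPartition K (classList e r f) := by
  rw [mem_starMaps] at hf
  rw [classList, isStarPartition_map_range]
  refine ⟨fun i hi => ?_, fun i hi j hj hij => ?_, fun x => ?_, ?_⟩
  · rcases eq_or_ne i r with rfl | hir
    · exact ⟨none, Finset.mem_filter.2 ⟨by simp, rfl⟩⟩
    · obtain ⟨j, hj⟩ := hf.2 i (by simp; omega) hir
      refine ⟨some ((e.symm j : K) : ℕ), ?_⟩
      rw [Finset.mem_filter, letterClass_symm]
      exact ⟨by simp, hj⟩
  · rw [Finset.disjoint_left]
    intro x hx hx'
    rw [Finset.mem_filter] at hx hx'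
    exact hij (hx.2.symm.trans hx'.2)
  · constructor
    · intro hx
      refine ⟨letterClass e r f x, ?_, by simp only [Finset.mem_filter, and_true]; exact hx⟩
      rcases x with _ | a
      · exact le_rfl
      · have ha : a ∈ K := by simpa using hx
        have := hf.1 (e ⟨a, ha⟩)
        simp only [Finset.mem_range] at this
        simp only [letterClass, ha, dif_pos]
        omega
    · rintro ⟨i, -, hx⟩
      exact (Finset.mem_filter.1 hx).1
  · exact Finset.mem_filter.2 ⟨by simp, rfl⟩

theorem classList_injOn :
    Set.InjOn (classList e r) (starMaps k (Finset.range (r + 1)) r : Set (Fin k → ℕ)) := by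
  intro f hf f' hf' h
  rw [Finset.mem_coe, mem_starMaps] at hf hf'
  funext j
  rw [classList, classList, List.map_inj_left] at h
  have h1 := h (f j) (by simpa using hf.1 j)
  have h2 : some ((e.symm j : K) : ℕ) ∈
      ({x ∈ K.insertNone | letterClass e r f x = f j} : Finset Letter) := by
    rw [Finset.mem_filter, letterClass_symm]
    simp
  rw [h1, Finset.mem_filter, letterClass_symm] at h2
  exact h2.2.symm

/-- Each number is sent to the index of its block. Block `r` is non-empty already because of the
star, which is why `starMaps` exempts the value `r`. -/
theorem exists_classList {L : List (Finset Letter)} (hL : IsStarPartition K L)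
    (hr : L.length = r + 1) :
    ∃ f ∈ starMaps k (Finset.range (r + 1)) r, classList e r f = L := by
  obtain ⟨B, rfl⟩ : ∃ B : ℕ → Finset Letter, L = (List.range (r + 1)).map B := by
    refine ⟨fun i => L.getD i ∅, List.ext_getElem (by simp [hr]) fun i h1 h2 => ?_⟩
    simp [h1]
  rw [isStarPartition_map_range] at hL
  obtain ⟨hne, hd, hc, hnone⟩ := hL
  have huniq : ∀ i ≤ r, ∀ j ≤ r, ∀ x, x ∈ B i → x ∈ B j → i = j := by
    intro i hi j hj x hx hx'
    by_contra h
    exact Finset.disjoint_left.1 (hd i hi j hj h) hx hx'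
  have hex : ∀ j : Fin k, ∃ i ≤ r, some ((e.symm j : K) : ℕ) ∈ B i :=
    fun j => (hc _).1 (by simp)
  choose f hfr hfB using hex
  have hclass : ∀ x ∈ K.insertNone, letterClass e r f x ≤ r ∧ x ∈ B (letterClass e r f x) := by
    intro x hx
    rcases x with _ | a
    · exact ⟨le_rfl, hnone⟩
    · have ha : a ∈ K := by simpa using hx
      simp only [letterClass, ha, dif_pos]
      exact ⟨hfr _, by simpa using hfB (e ⟨a, ha⟩)⟩
  refine ⟨f, mem_starMaps.2 ⟨fun j => by simpa [Nat.lt_succ_iff] using hfr j, fun b hb hbr => ?_⟩,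
    ?_⟩
  · have hb' : b ≤ r := by simpa [Nat.lt_succ_iff] using hb
    obtain ⟨x, hx⟩ := hne b hb'
    have hxK : x ∈ K.insertNone := (hc x).2 ⟨b, hb', hx⟩
    have hcl := hclass x hxK
    have := huniq _ hcl.1 _ hb' x hcl.2 hx
    rcases x with _ | a
    · exact absurd this.symm hbr
    · have ha : a ∈ K := by simpa using hxK
      simp only [letterClass, ha, dif_pos] at this
      exact ⟨_, this⟩
  · refine List.map_congr_left fun i hi => ?_
    have hi' : i ≤ r := by simpa [Nat.lt_succ_iff] using hi
    ext x
    rw [Finset.mem_filter]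
    constructor
    · rintro ⟨hx, rfl⟩
      exact (hclass x hx).2
    · intro hx
      have hxK : x ∈ K.insertNone := (hc x).2 ⟨i, hi', hx⟩
      exact ⟨hxK, huniq _ (hclass x hxK).1 _ hi' x (hclass x hxK).2 hx⟩

end ClassList

theorem ncard_isStarPartition (K : Finset ℕ) (r : ℕ) :
    {L | IsStarPartition K L ∧ L.length = r + 1}.Finite ∧
      {L | IsStarPartition K L ∧ L.length = r + 1}.ncard = starSurj K.card r := by
  have himg : {L | IsStarPartition K L ∧ L.length = r + 1} =
      classList K.equivFin r '' (starMaps K.card (Finset.range (r + 1)) r : Set _) := by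
    ext L
    constructor
    · rintro ⟨hL, hr⟩
      exact exists_classList _ r hL hr
    · rintro ⟨f, hf, rfl⟩
      exact ⟨isStarPartition_classList _ r hf, by simp [classList]⟩
  rw [himg]
  refine ⟨Finset.finite_toSet _ |>.image _, ?_⟩
  rw [(classList_injOn _ r).ncard_image, Set.ncard_coe_finset, card_starMaps _ (by simp)]
  simp

/-! ### Decomposition of barred sequences and the final count. -/

/-- Concatenate words of bars, each followed by its pair. -/
def encode : List (List Bar × BlockPair) → List Item
  | [] => []
  | q :: L => q.1.map Bar.toItem ++ .pair q.2 :: encode L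

theorem filterMap_pair?_map_toItem (w : List Bar) :
    (w.map Bar.toItem).filterMap Item.pair? = [] := by
  rw [List.filterMap_eq_nil_iff]
  intro y hy
  obtain ⟨x, -, rfl⟩ := List.mem_map.1 hy
  cases x <;> rfl

theorem filterMap_pair?_encode (L : List (List Bar × BlockPair)) :
    (encode L).filterMap Item.pair? = L.map Prod.snd := by
  induction L with
  | nil => rfl
  | cons q L ih =>
    rw [encode, List.filterMap_append, filterMap_pair?_map_toItem, List.nil_append,
      List.filterMap_cons_some (f := Item.pair?) (b := q.2) rfl, ih, List.map_cons]

theorem count_blueLabel?_map_toItem (w : List Bar) (i : ℕ) :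
    ((w.map Bar.toItem).filterMap Item.blueLabel?).count i = w.count (.blue i) := by
  induction w with
  | nil => rfl
  | cons x w ih =>
    cases x with
    | blue j =>
      rw [List.map_cons, List.filterMap_cons_some (f := Item.blueLabel?) (b := j) rfl, List.count_cons,
        List.count_cons, ih]
      simp
    | red j =>
      rw [List.map_cons, List.filterMap_cons_none (f := Item.blueLabel?) rfl, ih, List.count_cons]
      simp

theorem count_redLabel?_map_toItem (w : List Bar) (i : ℕ) :
    ((w.map Bar.toItem).filterMap Item.redLabel?).count i = w.count (.red i) := by
  induction w with
  | nil => rfl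
  | cons x w ih =>
    cases x with
    | blue j =>
      rw [List.map_cons, List.filterMap_cons_none (f := Item.redLabel?) rfl, ih, List.count_cons]
      simp
    | red j =>
      rw [List.map_cons, List.filterMap_cons_some (f := Item.redLabel?) (b := j) rfl, List.count_cons,
        List.count_cons, ih]
      simp

theorem count_blueLabel?_encode (L : List (List Bar × BlockPair)) (i : ℕ) :
    ((encode L).filterMap Item.blueLabel?).count i =
      (L.map Prod.fst).flatten.count (.blue i) := by
  induction L with
  | nil => rfl
  | cons q L ih =>
    rw [encode, List.filterMap_append, List.filterMap_cons_none rfl, List.count_append,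
      count_blueLabel?_map_toItem, ih, List.map_cons, List.flatten_cons, List.count_append]

theorem count_redLabel?_encode (L : List (List Bar × BlockPair)) (i : ℕ) :
    ((encode L).filterMap Item.redLabel?).count i =
      (L.map Prod.fst).flatten.count (.red i) := by
  induction L with
  | nil => rfl
  | cons q L ih =>
    rw [encode, List.filterMap_append, List.filterMap_cons_none rfl, List.count_append,
      count_redLabel?_map_toItem, ih, List.map_cons, List.flatten_cons, List.count_append]

theorem isChain_encode (L : List (List Bar × BlockPair)) :
    (encode L).IsChain Item.MayPrecede ↔ ∀ w ∈ L.map Prod.fst, GoodWord w := by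
  induction L with
  | nil => simp [encode]
  | cons q L ih =>
    rw [encode, List.isChain_split, List.map_cons, List.forall_mem_cons, ← ih, GoodWord]
    refine and_congr (isChain_append_singleton_congr fun y hy => ?_) ?_
    · obtain ⟨x, -, rfl⟩ := List.mem_map.1 hy
      cases x <;> rfl
    · cases h : encode L with
      | nil => simp
      | cons y t => simp [List.isChain_cons_cons, Item.MayPrecede]

theorem getLast?_encode_cons (q : List Bar × BlockPair) (L : List (List Bar × BlockPair)) :
    ∃ p, (encode (q :: L)).getLast? = some (.pair p) := by
  induction L generalizing q with
  | nil => exact ⟨q.2, by simp [encode]⟩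
  | cons q' L ih =>
    obtain ⟨p, hp⟩ := ih q'
    refine ⟨p, ?_⟩
    rw [encode, List.getLast?_append, List.getLast?_cons, hp]
    rfl

/-- The pairs act as delimiters: a word ends at the first item that is not a bar. -/
theorem encode_injective : Function.Injective encode := by
  have key : ∀ (w w' : List Bar) (p p' : BlockPair) (s s' : List Item),
      w.map Bar.toItem ++ .pair p :: s = w'.map Bar.toItem ++ .pair p' :: s' →
        w = w' ∧ p = p' ∧ s = s' := by
    intro w
    induction w with
    | nil =>
      intro w' p p' s s' h
      rcases w' with _ | ⟨x, w'⟩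
      · simpa using h
      · cases x <;> simp [Bar.toItem] at h
    | cons x w ih =>
      intro w' p p' s s' h
      rcases w' with _ | ⟨x', w'⟩
      · cases x <;> simp [Bar.toItem] at h
      · simp only [List.map_cons, List.cons_append, List.cons.injEq] at h
        obtain ⟨rfl, h2, h3⟩ := ih w' p p' s s' h.2
        refine ⟨?_, h2, h3⟩
        congr 1
        cases x <;> cases x' <;> simp [Bar.toItem] at h ⊢ <;> exact h.1
  intro L
  induction L with
  | nil =>
    intro L' h
    rcases L' with _ | ⟨q, L'⟩
    · rfl
    · simp [encode] at h
  | cons q L ih =>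
    intro L' h
    rcases L' with _ | ⟨q', L'⟩
    · simp [encode] at h
    · obtain ⟨h1, h2, h3⟩ := key _ _ _ _ _ _ h
      rw [ih h3, Prod.ext h1 h2]

theorem exists_encode {s : List Item} (hs : s = [] ∨ ∃ p, s.getLast? = some (.pair p)) :
    ∃ L, encode L = s := by
  induction s with
  | nil => exact ⟨[], rfl⟩
  | cons x t ih =>
    have ht : t = [] ∨ ∃ p, t.getLast? = some (.pair p) := by
      rcases t with _ | ⟨y, t⟩
      · exact .inl rfl
      · simpa [List.getLast?_cons_cons] using hs
    obtain ⟨L, rfl⟩ := ih ht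
    -- A leading bar joins the first word of the remainder, which exists because the sequence does
    -- not end in a bar.
    have hbar : ∀ b : Bar, x = b.toItem → ∃ L', encode L' = x :: encode L := by
      rintro b rfl
      rcases L with _ | ⟨q, L⟩
      · cases b <;> simp [encode, Bar.toItem] at hs
      · exact ⟨(b :: q.1, q.2) :: L, rfl⟩
    cases x with
    | blueBar i => exact hbar (.blue i) rfl
    | redBar i => exact hbar (.red i) rfl
    | pair p => exact ⟨([], p) :: L, rfl⟩

/-- A list of words into which the bars of an `m`-barred sequence are distributed. -/
def IsWordList (m : ℕ) (l : List (List Bar)) : Prop :=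
  (∀ w ∈ l, GoodWord w) ∧ ∀ x, l.flatten.count x = barLabels m x

theorem isBarred_encode (k n m : ℕ) (L : List (List Bar × BlockPair)) :
    IsBarred k n m (encode L) ↔ IsWordList m (L.map Prod.fst) ∧
      IsCallanSequence (Finset.Icc (m + 1) (m + k)) (Finset.Icc (m + 1) (m + n))
        (L.map Prod.snd) := by
  have hblue : ((encode L).filterMap Item.blueLabel?).Perm (List.range' 1 m) ↔
      ∀ i, (L.map Prod.fst).flatten.count (.blue i) = barLabels m (.blue i) := by
    rw [List.perm_iff_count]
    refine forall_congr' fun i => ?_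
    rw [count_blueLabel?_encode, List.Nodup.count List.nodup_range', barLabels]
    simp only [List.mem_range'_1]
    rw [if_congr (show (1 ≤ i ∧ i < 1 + m) ↔ (1 ≤ i ∧ i ≤ m) by omega) rfl rfl]
  have hred : ((encode L).filterMap Item.redLabel?).Perm (List.range (m + 1)) ↔
      ∀ i, (L.map Prod.fst).flatten.count (.red i) = barLabels m (.red i) := by
    rw [List.perm_iff_count]
    refine forall_congr' fun i => ?_
    rw [count_redLabel?_encode, List.Nodup.count List.nodup_range, barLabels]
    simp only [List.mem_range, Nat.lt_succ_iff]
  constructor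
  · intro h
    refine ⟨⟨(isChain_encode L).1 h.chain, ?_⟩, filterMap_pair?_encode L ▸ h.pairs⟩
    rintro (i | i)
    · exact hblue.1 h.blueBars i
    · exact hred.1 h.redBars i
  · rintro ⟨hw, hc⟩
    refine ⟨hblue.2 fun i => hw.2 _, hred.2 fun i => hw.2 _, (filterMap_pair?_encode L).symm ▸ hc,
      (isChain_encode L).2 hw.1, ?_⟩
    rcases L with _ | ⟨q, L⟩
    · obtain ⟨o, e, h, -⟩ := hc
      simp at h
    · exact getLast?_encode_cons q L

theorem ncard_isWordList (m n : ℕ) : {l | IsWordList m l ∧ l.length = n}.Finite ∧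
    ({l | IsWordList m l ∧ l.length = n}.ncard : ℚ) = gandhi m n := by
  have hcount : ∀ (w : ℕ → List Bar) x, ((List.range n).map w).flatten.count x =
      ∑ i ∈ Finset.range n, (w i).count x := by
    intro w x
    rw [List.count_flatten, List.map_map]
    rfl
  have himg : {l | IsWordList m l ∧ l.length = n} =
      (fun w => (List.range n).map w) '' {w | IsWords m (Finset.range n) w} := by
    ext l
    constructor
    · rintro ⟨hl, hn⟩
      have e : (List.range n).map (fun i => l.getD i []) = l := by
        refine List.ext_getElem (by simp [hn]) fun i h1 h2 => ?_
        simp [h2]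
      refine ⟨fun i => l.getD i [], ⟨fun i hi => ?_, fun i => ?_, fun x => ?_⟩, e⟩
      · have : l.length ≤ i := by simpa [hn] using hi
        simp [this]
      · rcases lt_or_ge i l.length with h | h
        · simp only [List.getD_eq_getElem _ _ h]
          exact hl.1 _ (List.getElem_mem h)
        · simp only [List.getD_eq_default _ _ h]
          exact goodWord_nil
      · rw [← hcount, e, hl.2]
    · rintro ⟨w, hw, rfl⟩
      refine ⟨⟨fun v hv => ?_, fun x => ?_⟩, by simp⟩
      · obtain ⟨i, -, rfl⟩ := List.mem_map.1 hv
        exact hw.good i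
      · rw [hcount, hw.count]
  have h := ncard_isWords m (Finset.range n)
  rw [himg]
  refine ⟨h.1.image _, ?_⟩
  rw [Set.InjOn.ncard_image, h.2, Finset.card_range]
  intro w hw w' hw' hww
  funext i
  by_cases hi : i < n
  · exact List.map_inj_left.1 hww i (by simpa using hi)
  · rw [hw.supp i (by simpa using hi), hw'.supp i (by simpa using hi)]

theorem ncard_list_prod {α β : Type*} (n : ℕ) {P : Set (List α)} {Q : Set (List β)}
    (hP : ∀ l ∈ P, l.length = n) (hQ : ∀ l ∈ Q, l.length = n) (hPf : P.Finite) (hQf : Q.Finite) :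
    {L : List (α × β) | L.map Prod.fst ∈ P ∧ L.map Prod.snd ∈ Q}.Finite ∧
      {L : List (α × β) | L.map Prod.fst ∈ P ∧ L.map Prod.snd ∈ Q}.ncard = P.ncard * Q.ncard := by
  have himg : {L : List (α × β) | L.map Prod.fst ∈ P ∧ L.map Prod.snd ∈ Q} =
      (fun t : List α × List β => t.1.zip t.2) '' (P ×ˢ Q) := by
    ext L
    constructor
    · intro h
      exact ⟨(L.map Prod.fst, L.map Prod.snd), h, (List.zip_of_prod rfl rfl).symm⟩
    · rintro ⟨⟨a, b⟩, ⟨ha, hb⟩, rfl⟩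
      have hl : a.length = b.length := (hP a ha).trans (hQ b hb).symm
      refine ⟨?_, ?_⟩
      · rwa [List.map_fst_zip hl.le]
      · rwa [List.map_snd_zip hl.ge]
  rw [himg]
  refine ⟨(hPf.prod hQf).image _, ?_⟩
  rw [Set.InjOn.ncard_image, Set.ncard_prod]
  rintro ⟨a, b⟩ ⟨ha, hb⟩ ⟨a', b'⟩ ⟨ha', hb'⟩ h
  have hl : a.length = b.length := (hP a ha).trans (hQ b hb).symm
  have hl' : a'.length = b'.length := (hP a' ha').trans (hQ b' hb').symm
  simp only at h
  have h1 := congrArg (List.map Prod.fst) h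
  have h2 := congrArg (List.map Prod.snd) h
  rw [List.map_fst_zip hl.le, List.map_fst_zip hl'.le] at h1
  rw [List.map_snd_zip hl.ge, List.map_snd_zip hl'.ge] at h2
  rw [h1, h2]

theorem ncard_isCallanSequence (K N : Finset ℕ) (r : ℕ) :
    {c | IsCallanSequence K N c ∧ c.length = r + 1}.Finite ∧
      {c | IsCallanSequence K N c ∧ c.length = r + 1}.ncard =
        starSurj K.card r * starSurj N.card r := by
  have hK := ncard_isStarPartition K r
  have hN := ncard_isStarPartition N r
  have h := ncard_list_prod (r + 1) (fun l hl => hl.2) (fun l hl => hl.2) hK.1 hN.1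
  rw [hK.2, hN.2] at h
  convert h using 3 <;>
  · ext c
    simp only [Set.mem_ofPred_eq, isCallanSequence_iff, List.length_map]
    tauto

theorem exists_length_isCallanSequence {K N : Finset ℕ} {c : List BlockPair}
    (hc : IsCallanSequence K N c) : ∃ r ≤ K.card, c.length = r + 1 := by
  obtain ⟨r, hr⟩ : ∃ r, c.length = r + 1 := by
    obtain ⟨o, e, rfl, -⟩ := hc
    exact ⟨o.length, by simp⟩
  refine ⟨r, ?_, hr⟩
  by_contra h
  -- The bound on the length comes from the count itself: `starSurj` vanishes beyond the diagonal,
  -- and a finite set of cardinality 0 is empty.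
  have h1 := ncard_isCallanSequence K N r
  rw [starSurj_eq_zero (not_le.1 h), zero_mul, Set.ncard_eq_zero h1.1] at h1
  have : c ∈ (∅ : Set (List BlockPair)) := h1.2 ▸ ⟨hc, hr⟩
  exact this

/-- The bound `M` is left free so that one range of `r` serves all terms of the alternating sum and
the two sums can be exchanged. -/
theorem barredCount_eq_sum (k n m M : ℕ) (hM : k ≤ M) : (barredCount k n m : ℚ) =
    ∑ r ∈ Finset.range (M + 1), ((starSurj k r : ℚ) * starSurj n r) * gandhi m (r + 1) := by
  set K := Finset.Icc (m + 1) (m + k) with hK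
  set N := Finset.Icc (m + 1) (m + n) with hN
  have hKc : K.card = k := by simp [hK]
  have hNc : N.card = n := by simp [hN]
  let T : ℕ → Set (List (List Bar × BlockPair)) := fun r =>
    {L | L.map Prod.fst ∈ {l | IsWordList m l ∧ l.length = r + 1} ∧
      L.map Prod.snd ∈ {c | IsCallanSequence K N c ∧ c.length = r + 1}}
  have hT : ∀ r, (T r).Finite ∧
      ((T r).ncard : ℚ) = ((starSurj k r : ℚ) * starSurj n r) * gandhi m (r + 1) := by
    intro r
    have hw := ncard_isWordList m (r + 1)
    have hc := ncard_isCallanSequence K N r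
    have h := ncard_list_prod (r + 1) (fun l hl => hl.2) (fun l hl => hl.2) hw.1 hc.1
    refine ⟨h.1, ?_⟩
    rw [h.2, Nat.cast_mul, hw.2, hc.2, hKc, hNc]
    push_cast
    ring
  let F : ℕ → Finset (List (List Bar × BlockPair)) := fun r => (hT r).1.toFinset
  have hset : {s : List Item | IsBarred k n m s} =
      encode '' ((Finset.range (M + 1)).biUnion F : Set _) := by
    ext s
    simp only [Set.mem_ofPred_eq, Set.mem_image, Finset.mem_coe, Finset.mem_biUnion,
      Finset.mem_range, F, Set.Finite.mem_toFinset]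
    constructor
    · intro hs
      obtain ⟨L, rfl⟩ := exists_encode (.inr hs.last)
      obtain ⟨hw, hc⟩ := (isBarred_encode k n m L).1 hs
      obtain ⟨r, hr, hlen⟩ := exists_length_isCallanSequence hc
      refine ⟨L, ⟨r, ?_, ⟨hw, ?_⟩, hc, hlen⟩, rfl⟩
      · rw [← hK, hKc] at hr
        omega
      · simpa using hlen
    · rintro ⟨L, ⟨r, -, hL⟩, rfl⟩
      exact (isBarred_encode k n m L).2 ⟨hL.1.1, hL.2.1⟩
  rw [barredCount, hset, Set.ncard_image_of_injective _ encode_injective, Set.ncard_coe_finset,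
    Finset.card_biUnion, Nat.cast_sum]
  · refine Finset.sum_congr rfl fun r _ => ?_
    rw [← (hT r).2, Set.ncard_eq_toFinset_card _ (hT r).1]
  · intro r _ r' _ hne
    rw [Function.onFun, Finset.disjoint_left]
    intro L hL hL'
    simp only [F, Set.Finite.mem_toFinset] at hL hL'
    have h1 := hL.1.2
    have h2 := hL'.1.2
    omega

end Callan

theorem theorem3p2 (n m : ℕ) :
    ∑ j ∈ Finset.range (n + 1), (-1 : ℚ) ^ j * (Callan.barredCount j (n - j) m : ℚ) =
      (-1 : ℚ) ^ (m + 1) * Callan.genocchi (n + 2 * m + 2) := by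
  rw [← Callan.alternating_sum_eq_genocchi n m (n + 1) n.lt_succ_self]
  simp only [Callan.starConv, Finset.sum_mul]
  rw [Finset.sum_comm]
  refine Finset.sum_congr rfl fun j hj => ?_
  have hj' : j ≤ n := by simpa [Nat.lt_succ_iff] using hj
  rw [Callan.barredCount_eq_sum j (n - j) m (n + 1) (by omega), Finset.mul_sum]
  simp only [mul_assoc]
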